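/- Let $(W_k)_{k\ge 0}$ be the symmetric nearest-neighbour random walk on $\mathbb{Z}^2$ (each step is $(\pm1,0)$ or $(0,\pm1)$ with probability $1/4$), let $p_k(t,s)=\mathrm{P}(W_k=(t,s)\mid W_0=(0,0))$, and let $$g_4(t,s,a)=\sum_{k=0}^\infty a^k p_k(t,s),\qquad (t,s)\in\mathbb{Z}^2,\ a\in[0,1),$$ be its lattice Green function. For $(t,s)\in\mathbb{R}^2\setminus\{(0,0)\}$ and $z>0$ put $$h_4(t,s,z)=\frac{2}{\pi}K_0\big(2\sqrt{z(t^2+s^2)}\big),$$ where $K_0(x)=\int_0^\infty e^{-x\cosh u}\,du$, $x>0$, is the modified Bessel function of the second kind of order $0$. Let $[x]$ denote the integer part (floor) of $x\in\mathbb{R}$. Then: (i) For any $(t,s)\in\mathbb{R}^2\setminus\{(0,0)\}$ and $z>0$, as $\lambda\to\infty$ ($\lambda$ real), $$g_4\big([\lambda t],[\lambda s],1-\tfrac{z}{\lambda^2}\big)\to h_4(t,s,z).$$ (ii) For every $\epsilon>0$ this convergence is uniform on the set $\{(t,s,z):\epsilon<|t|+|s|<1/\epsilon,\ \epsilon<z<1/\epsilon\}$.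 (iii) There exist constants $C,c>0$ such that for all sufficiently large $\lambda$ and all $(t,s)\in\mathbb{R}^2\setminus\{(0,0)\}$, $0<z<\lambda^2$, $$g_4\big([\lambda t],[\lambda s],1-\tfrac{z}{\lambda^2}\big)<C\Big\{h_4(t,s,z)+e^{-c\sqrt{\lambda}\,(|t|^{1/2}+|s|^{1/2})}\Big\}.$$ -/

import Mathlib

open Filter Topology MeasureTheory

/-- The four nearest neighbours of the origin in `ℤ²`. -/
def neighbors4 : Finset (ℤ × ℤ) := {(1, 0), (-1, 0), (0, 1), (0, -1)}

theorem neighbors4_nonempty : neighbors4.Nonempty := ⟨(1, 0), by simp [neighbors4]⟩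

/-- One-step law of the symmetric nearest-neighbour walk: each neighbour has probability `1/4`. -/
noncomputable def stepLaw4 : PMF (ℤ × ℤ) := PMF.uniformOfFinset neighbors4 neighbors4_nonempty

/-- The law of `W_k`, for the walk `W` started at `W_0 = (0, 0)`: each step adds to the current
position an independent increment with law `stepLaw4`. -/
noncomputable def walkLaw4 : ℕ → PMF (ℤ × ℤ)
  | 0 => PMF.pure (0, 0)
  | k + 1 => (walkLaw4 k).bind fun w => stepLaw4.map fun e => w + e

/-- The `k`-step probability `p_k(t, s) = P(W_k = (t, s) | W_0 = (0, 0))`. -/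
noncomputable def stepProb4 (k : ℕ) (t s : ℤ) : ℝ := (walkLaw4 k (t, s)).toReal

/-- The lattice Green function `g₄(t, s, a) = ∑_{k ≥ 0} a^k p_k(t, s)`. -/
noncomputable def green4 (t s : ℤ) (a : ℝ) : ℝ := ∑' k : ℕ, a ^ k * stepProb4 k t s

/-- The series defining `green4 t s a` converges for `0 ≤ a < 1`. -/
theorem summable_green4 (t s : ℤ) {a : ℝ} (h0 : 0 ≤ a) (h1 : a < 1) :
    Summable fun k : ℕ => a ^ k * stepProb4 k t s := by
  refine Summable.of_nonneg_of_le (fun k => mul_nonneg (pow_nonneg h0 k) ENNReal.toReal_nonneg)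
    (fun k => ?_) (summable_geometric_of_lt_one h0 h1)
  refine mul_le_of_le_one_right (pow_nonneg h0 k) ?_
  have h := ENNReal.toReal_mono ENNReal.one_ne_top ((walkLaw4 k).coe_le_one (t, s))
  simpa [stepProb4] using h

/-- The modified Bessel function of the second kind of order zero, on `x > 0`:
`K₀(x) = ∫₀^∞ exp(-x cosh u) du`. -/
noncomputable def besselK0 (x : ℝ) : ℝ := ∫ u in Set.Ioi (0 : ℝ), Real.exp (-x * Real.cosh u)

/-- The integral defining `besselK0 x` converges for `x > 0`. -/
theorem integrableOn_besselK0 {x : ℝ} (hx : 0 < x) :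
    IntegrableOn (fun u : ℝ => Real.exp (-x * Real.cosh u)) (Set.Ioi 0) := by
  have hi : IntegrableOn (fun u : ℝ => Real.exp (-(x / 2) * u)) (Set.Ioi 0) :=
    integrableOn_exp_mul_Ioi (by linarith) 0
  refine Integrable.mono' hi (by fun_prop) (ae_of_all _ fun u => ?_)
  rw [Real.norm_eq_abs, abs_of_pos (Real.exp_pos _)]
  apply Real.exp_le_exp.mpr
  have h : u / 2 ≤ Real.cosh u := by
    rw [Real.cosh_eq]
    linarith [Real.add_one_le_exp u, Real.exp_pos (-u)]
  nlinarith

/-- The limit function `h₄(t, s, z) = (2/π) K₀(2 √(z (t² + s²)))`. -/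
noncomputable def h4 (t s z : ℝ) : ℝ :=
  2 / Real.pi * besselK0 (2 * Real.sqrt (z * (t ^ 2 + s ^ 2)))

/-! In the rotated coordinates `t + s` and `t - s` the planar walk is a pair of independent simple
walks on `ℤ`, so `stepProb4` is a product of two values of `walk1` (`stepProb4_eq`). The ratio
recursion `walk1_ratio` compares each value of `walk1 k` with its mode, and Wallis' product gives
the size of the mode. On the parity class of the end point, `p_k(t, s)` is thus close to `(2 / (π
k)) exp (-(t² + s²) / k)`; a bound of this Gaussian shape holds for all `k`, `t`, `s`
(`stepProb4_le`).

With time scaled by `λ²`, the Green function is the integral of a step function that converges to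
`(1/π) exp (-z u - R / u) / u`, where `R = t² + s²`. The substitution `u = √(R / z) e^y` turns the
integral of this limit into `(2/π) K₀(2 √(z R))`. Dominated convergence applies because the Gaussian
factor controls small times and the killing `(1 - z / λ²)^k` controls large ones. It is run along an
arbitrary countably generated filter with moving parameters (`tendsto_green4`), so that it also
yields uniformity on compact sets.

For the global bound, times `k + 1 ≥ |n| + |m|`, with `(n, m)` the lattice end point, are compared
with the Bessel integral. Shorter times contribute at most a multiple of `exp (-(|n| + |m|) / 4)`.
-/

/-! ### The one-dimensional walk and Wallis' product -/

/-- The `k`-step law of the symmetric nearest-neighbour walk on `ℤ` started at `0`. -/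
noncomputable def walk1 : ℕ → ℤ → ℝ
  | 0, n => if n = 0 then 1 else 0
  | k + 1, n => (walk1 k (n - 1) + walk1 k (n + 1)) / 2

theorem walk1_zero (n : ℤ) : walk1 0 n = if n = 0 then 1 else 0 := rfl

theorem walk1_succ (k : ℕ) (n : ℤ) :
    walk1 (k + 1) n = (walk1 k (n - 1) + walk1 k (n + 1)) / 2 := rfl

theorem walk1_nonneg (k : ℕ) (n : ℤ) : 0 ≤ walk1 k n := by
  induction k generalizing n with
  | zero => rw [walk1_zero]; split_ifs <;> norm_num
  | succ k ih => rw [walk1_succ]; linarith [ih (n - 1), ih (n + 1)]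

theorem walk1_neg (k : ℕ) (n : ℤ) : walk1 k (-n) = walk1 k n := by
  induction k generalizing n with
  | zero => simp [walk1_zero]
  | succ k ih =>
    rw [walk1_succ, walk1_succ, ← ih (n - 1), ← ih (n + 1), add_comm]
    congr 3 <;> ring_nf

theorem walk1_natAbs (k : ℕ) (n : ℤ) : walk1 k (n.natAbs : ℤ) = walk1 k n := by
  rcases Int.natAbs_eq n with h | h
  · rw [← h]
  · nth_rewrite 2 [h]; rw [walk1_neg]

theorem walk1_eq_zero_of_odd (k : ℕ) (n : ℤ) (h : Odd (k + n)) : walk1 k n = 0 := by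
  induction k generalizing n with
  | zero =>
    rw [walk1_zero, if_neg]
    rintro rfl
    simp at h
  | succ k ih =>
    rw [walk1_succ, ih, ih]
    · simp
    · obtain ⟨r, hr⟩ := h; exact ⟨r, by push_cast at hr; linarith⟩
    · obtain ⟨r, hr⟩ := h; exact ⟨r - 1, by push_cast at hr; linarith⟩

/-- This is the quotient of neighbouring binomial coefficients. Without division it holds for every
`n`, off the support and off the parity class too, so the induction is linear and needs no cases. -/
theorem walk1_ratio (k : ℕ) (n : ℤ) :
    ((k : ℝ) + n + 2) * walk1 k (n + 2) = (k - n) * walk1 k n := by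
  induction k generalizing n with
  | zero =>
    simp only [walk1_zero]
    by_cases h1 : n = 0
    · subst h1; norm_num
    · by_cases h2 : n + 2 = 0
      · have : n = -2 := by omega
        subst this; norm_num
      · simp [h1, h2]
  | succ k ih =>
    have h1 := ih (n + 1)
    have h2 := ih (n - 1)
    rw [walk1_succ, walk1_succ]
    rw [show n + 1 + 2 = n + 2 + 1 by ring] at h1
    rw [show n - 1 + 2 = n + 1 by ring] at h2
    rw [show n + 2 - 1 = n + 1 by ring]
    push_cast at h1 h2 ⊢
    linear_combination h1 / 2 + h2 / 2

theorem walk1_odd_one (j : ℕ) :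
    walk1 (2 * j + 1) 1 = walk1 (2 * j) 0 * ((2 * j + 1) / (2 * j + 2)) := by
  have h := walk1_ratio (2 * j) 0
  have hj : (2 * (j : ℝ) + 2) ≠ 0 := by positivity
  rw [walk1_succ]
  norm_num at h ⊢
  field_simp
  linear_combination h / 2

theorem walk1_even_zero (j : ℕ) : walk1 (2 * j + 2) 0 = walk1 (2 * j + 1) 1 := by
  rw [show 2 * j + 2 = (2 * j + 1) + 1 by ring, walk1_succ]
  have := walk1_neg (2 * j + 1) 1
  simp [this]

/-- Passing from `2j` to `2j + 2` multiplies the return probability by `(2j + 1) / (2j + 2)`, whose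
square is matched by the next Wallis factor. -/
theorem walk1_even_zero_sq (j : ℕ) :
    walk1 (2 * j) 0 ^ 2 * (2 * j + 1) * Real.Wallis.W j = 1 := by
  induction j with
  | zero => simp [walk1_zero, Real.Wallis.W]
  | succ j ih =>
    refine Eq.trans ?_ ih
    rw [show 2 * (j + 1) = 2 * j + 2 by ring, walk1_even_zero, walk1_odd_one, Real.Wallis.W_succ]
    push_cast
    have h1 : (2 * (j : ℝ) + 1) ≠ 0 := by positivity
    have h2 : (2 * (j : ℝ) + 2) ≠ 0 := by positivity
    have h3 : (2 * (j : ℝ) + 3) ≠ 0 := by positivity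
    have h4 : (2 * ((j : ℝ) + 1) + 1) ≠ 0 := by positivity
    field_simp
    ring

/-- The mode `walk1 k (k % 2)` of the `k`-step law. -/
noncomputable def walk1Mode (k : ℕ) : ℝ := walk1 k ((k % 2 : ℕ) : ℤ)

theorem walk1Mode_nonneg (k : ℕ) : 0 ≤ walk1Mode k := walk1_nonneg _ _

theorem walk1Mode_bounds (k : ℕ) :
    ((k : ℝ) + 1) / (k + 2) ≤ Real.pi / 2 * ((k + 1) * walk1Mode k ^ 2) ∧
      Real.pi / 2 * ((k + 1) * walk1Mode k ^ 2) ≤ ((k : ℝ) + 2) / (k + 1) := by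
  have hpi := Real.pi_pos
  have key : ∀ j : ℕ, 1 ≤ Real.pi / 2 * (walk1 (2 * j) 0 ^ 2 * (2 * j + 1)) ∧
      Real.pi / 2 * (walk1 (2 * j) 0 ^ 2 * (2 * j + 1)) ≤ (2 * j + 2) / (2 * j + 1) := by
    intro j
    have h := walk1_even_zero_sq j
    have h1 := Real.Wallis.W_le j
    have h2 := Real.Wallis.le_W j
    set X := walk1 (2 * j) 0 ^ 2 * (2 * j + 1) with hX
    have hX0 : 0 ≤ X := by positivity
    constructor
    · nlinarith
    · rw [le_div_iff₀ (by positivity)]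
      rw [div_mul_eq_mul_div, div_le_iff₀ (by positivity)] at h2
      nlinarith
  rcases Nat.even_or_odd' k with ⟨j, rfl | rfl⟩
  · obtain ⟨h1, h2⟩ := key j
    have hm : walk1Mode (2 * j) = walk1 (2 * j) 0 := by simp [walk1Mode]
    rw [hm]
    push_cast
    rw [mul_comm (2 * (j : ℝ) + 1)]
    refine ⟨le_trans ?_ h1, h2⟩
    rw [div_le_one (by positivity)]; linarith
  · obtain ⟨h1, h2⟩ := key (j + 1)
    -- Odd times reduce to even ones: `0` at time `2j + 2` is reached from `±1`, which are equally
    -- likely.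
    have hm : walk1Mode (2 * j + 1) = walk1 (2 * (j + 1)) 0 := by
      rw [walk1Mode, show (2 * j + 1) % 2 = 1 by omega, show 2 * (j + 1) = 2 * j + 2 by ring,
        walk1_even_zero]; simp
    rw [hm]
    push_cast at h1 h2 ⊢
    set Y := walk1 (2 * (j + 1)) 0 ^ 2
    have hj : (0 : ℝ) ≤ j := j.cast_nonneg
    rw [le_div_iff₀ (by positivity)] at h2
    rw [div_le_iff₀ (by positivity), le_div_iff₀ (by positivity)]
    have hY : 0 ≤ Real.pi / 2 * Y := by positivity
    constructor
    · nlinarith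
    · nlinarith

/-! ### Gaussian bounds in dimension one -/

/-- For `x < 1` this is `artanh x ≥ x`. With `x = (m + 1) / (k + 1)`, the quotient `(1 - x) / (1 +
x)` is the ratio `(k - m) / (k + m + 2)` of `walk1_ratio`. -/
theorem one_sub_le_one_add_mul_exp {x : ℝ} (h0 : 0 ≤ x) :
    1 - x ≤ (1 + x) * Real.exp (-(2 * x)) := by
  rcases lt_or_ge x 1 with h1 | h1
  · have hy : 0 ≤ 2 * x / (1 - x) := div_nonneg (mul_nonneg zero_le_two h0) (by linarith)
    have h := Real.le_log_one_add_of_nonneg hy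
    have hx : (1 - x) ≠ 0 := by linarith
    have e1 : 2 * (2 * x / (1 - x)) / (2 * x / (1 - x) + 2) = 2 * x := by
      field_simp; ring
    have e2 : 1 + 2 * x / (1 - x) = (1 + x) / (1 - x) := by field_simp; ring
    rw [e1, e2, Real.le_log_iff_exp_le (div_pos (by linarith) (by linarith)),
      le_div_iff₀ (by linarith)] at h
    rw [Real.exp_neg, ← div_eq_mul_inv, le_div_iff₀ (Real.exp_pos _)]
    linarith
  · have : 0 ≤ (1 + x) * Real.exp (-(2 * x)) := by positivity
    linarith

theorem exp_neg_le_one_sub {x : ℝ} (h1 : x ≤ 1 / 2) :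
    Real.exp (-x - 2 * x ^ 2) ≤ 1 - x := by
  rw [show -x - 2 * x ^ 2 = -(x + 2 * x ^ 2) by ring, Real.exp_neg]
  apply inv_le_of_inv_le₀ (by linarith)
  refine le_trans ?_ (Real.add_one_le_exp _)
  rw [inv_le_iff_one_le_mul₀ (by linarith)]
  nlinarith [mul_nonneg (sq_nonneg x) (by linarith : 0 ≤ 1 / 2 - x)]

/-- The exponents telescope, since `2 (m + 1) / (k + 1) = ((m + 2)² - m²) / (2 (k + 1))`. The `-1`
makes the base case `n = 1` exact. -/
theorem walk1_nat_le (k : ℕ) (n : ℕ) (h : n % 2 = k % 2) :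
    walk1 k n ≤ walk1Mode k * Real.exp (-((n : ℝ) ^ 2 - 1) / (2 * (k + 1))) := by
  induction n using Nat.strong_induction_on with
  | _ n ih =>
    have hb := walk1Mode_nonneg k
    rcases lt_or_ge n 2 with hn | hn
    · have : walk1 k n = walk1Mode k := by
        rw [walk1Mode, ← h, Nat.mod_eq_of_lt hn]
      rw [this]
      apply le_mul_of_one_le_right hb
      apply Real.one_le_exp
      apply div_nonneg _ (by positivity)
      have : (n : ℝ) ≤ 1 := by exact_mod_cast Nat.lt_succ_iff.mp hn
      nlinarith [(n.cast_nonneg : (0 : ℝ) ≤ n)]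
    · obtain ⟨m, rfl⟩ := Nat.exists_eq_add_of_le' hn
      have hm := ih m (by omega) (by omega)
      have hr := walk1_ratio k m
      have hq := walk1_nonneg k m
      have hk : (0 : ℝ) < k + 1 := by positivity
      have hx := one_sub_le_one_add_mul_exp (x := ((m : ℝ) + 1) / (k + 1)) (by positivity)
      have hx' : ((k : ℝ) - m) ≤ (k + m + 2) * Real.exp (-(2 * (((m : ℝ) + 1) / (k + 1)))) := by
        have h1 := mul_le_mul_of_nonneg_left hx hk.le
        have h2 : ((k : ℝ) + 1) * (((m : ℝ) + 1) / (k + 1)) = m + 1 := by field_simp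
        rw [← mul_assoc, mul_sub, mul_add, h2] at h1
        rw [show ((k : ℝ) + 1) * 1 - (m + 1) = k - m by ring,
          show ((k : ℝ) + 1) * 1 + (m + 1) = k + m + 2 by ring] at h1
        exact h1
      have hpos : (0 : ℝ) < k + m + 2 := by positivity
      have e : Real.exp (-(((m + 2 : ℕ) : ℝ) ^ 2 - 1) / (2 * (k + 1))) =
          Real.exp (-((m : ℝ) ^ 2 - 1) / (2 * (k + 1))) *
            Real.exp (-(2 * (((m : ℝ) + 1) / (k + 1)))) := by
        rw [← Real.exp_add]; congr 1; push_cast; field_simp; ring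
      rw [e]
      push_cast at hr ⊢
      have : (k + m + 2) * walk1 k (m + 2) ≤ (k + m + 2) * (walk1 k m *
          Real.exp (-(2 * (((m : ℝ) + 1) / (k + 1))))) := by
        rw [hr]
        nlinarith
      refine (le_of_mul_le_mul_left this hpos).trans ?_
      rw [← mul_assoc]
      exact mul_le_mul_of_nonneg_right hm (Real.exp_pos _).le

/-- The same telescoping with `(1 - x) / (1 + x) ≥ exp (-2x - 2x²)`, valid for `0 ≤ x ≤ 1/2`, which
`hn` guarantees. The cubic term absorbs the sum of the errors `2x²`. -/
theorem walk1_nat_ge (k : ℕ) (n : ℕ) (h : n % 2 = k % 2) (hn : 2 * n ≤ k + 1) :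
    walk1Mode k * Real.exp (-(n : ℝ) ^ 2 / (2 * (k + 1)) - (n : ℝ) ^ 3 / (k + 1) ^ 2) ≤
      walk1 k n := by
  induction n using Nat.strong_induction_on with
  | _ n ih =>
    have hb := walk1Mode_nonneg k
    have hk : (0 : ℝ) < k + 1 := by positivity
    rcases lt_or_ge n 2 with hn2 | hn2
    · have : walk1 k n = walk1Mode k := by
        rw [walk1Mode, ← h, Nat.mod_eq_of_lt hn2]
      rw [this]
      apply mul_le_of_le_one_right hb
      rw [Real.exp_le_one_iff, sub_nonpos]
      refine le_trans ?_ (by positivity : (0 : ℝ) ≤ (n : ℝ) ^ 3 / (k + 1) ^ 2)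
      rw [neg_div, neg_nonpos]; positivity
    · obtain ⟨m, rfl⟩ := Nat.exists_eq_add_of_le' hn2
      have hm := ih m (by omega) (by omega) (by omega)
      have hr := walk1_ratio k m
      have hq := walk1_nonneg k m
      have hn' : 2 * ((m : ℝ) + 2) ≤ k + 1 := by exact_mod_cast hn
      set x : ℝ := ((m : ℝ) + 1) / (k + 1) with hxdef
      have hx0 : 0 ≤ x := by positivity
      have hx12 : x ≤ 1 / 2 := by
        rw [hxdef, div_le_iff₀ hk]; linarith
      have hx := exp_neg_le_one_sub hx12
      have hx2 : (1 + x) * Real.exp (-x) ≤ 1 := by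
        rw [Real.exp_neg, ← div_eq_mul_inv, div_le_one (Real.exp_pos _)]
        linarith [Real.add_one_le_exp x]
      have hx3 : (1 + x) * Real.exp (-(2 * x) - 2 * x ^ 2) ≤ 1 - x := by
        rw [show -(2 * x) - 2 * x ^ 2 = -x + (-x - 2 * x ^ 2) by ring, Real.exp_add, ← mul_assoc]
        refine le_trans (mul_le_of_le_one_left (Real.exp_pos _).le hx2) hx
      have hkx : ((k : ℝ) + 1) * x = m + 1 := by rw [hxdef]; field_simp
      have hx' : (k + m + 2) * Real.exp (-(2 * x) - 2 * x ^ 2) ≤ (k : ℝ) - m := by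
        have := mul_le_mul_of_nonneg_left hx3 hk.le
        rw [← mul_assoc] at this
        have e1 : ((k : ℝ) + 1) * (1 + x) = k + m + 2 := by linarith
        have e2 : ((k : ℝ) + 1) * (1 - x) = k - m := by linarith
        rwa [e1, e2] at this
      have hpos : (0 : ℝ) < k + m + 2 := by positivity
      have e : Real.exp (-((m + 2 : ℕ) : ℝ) ^ 2 / (2 * (k + 1)) -
            ((m + 2 : ℕ) : ℝ) ^ 3 / (k + 1) ^ 2) ≤
          Real.exp (-(m : ℝ) ^ 2 / (2 * (k + 1)) - (m : ℝ) ^ 3 / (k + 1) ^ 2) *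
            Real.exp (-(2 * x) - 2 * x ^ 2) := by
        rw [← Real.exp_add]
        apply Real.exp_le_exp.mpr
        have : (-(m : ℝ) ^ 2 / (2 * (k + 1)) - (m : ℝ) ^ 3 / (k + 1) ^ 2
            + (-(2 * x) - 2 * x ^ 2)) - (-((m + 2 : ℕ) : ℝ) ^ 2 / (2 * (k + 1)) -
            ((m + 2 : ℕ) : ℝ) ^ 3 / (k + 1) ^ 2) = (4 * m ^ 2 + 8 * m + 6) / (k + 1) ^ 2 := by
          rw [hxdef]; push_cast; field_simp; ring
        have h0 : (0 : ℝ) ≤ (4 * m ^ 2 + 8 * m + 6) / (k + 1) ^ 2 := by positivity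
        linarith
      push_cast at hr e ⊢
      have : (k + m + 2) * (walk1 k m * Real.exp (-(2 * x) - 2 * x ^ 2)) ≤
          (k + m + 2) * walk1 k (m + 2) := by
        rw [hr]
        nlinarith
      refine le_trans ?_ (le_of_mul_le_mul_left this hpos)
      refine (mul_le_mul_of_nonneg_left e hb).trans ?_
      rw [← mul_assoc]
      exact mul_le_mul_of_nonneg_right hm (Real.exp_pos _).le

theorem walk1_le (k : ℕ) (n : ℤ) :
    walk1 k n ≤ walk1Mode k * Real.exp (-((n : ℝ) ^ 2 - 1) / (2 * (k + 1))) := by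
  by_cases h : Odd (k + n)
  · rw [walk1_eq_zero_of_odd k n h]
    exact mul_nonneg (walk1Mode_nonneg k) (Real.exp_pos _).le
  · have h' : n.natAbs % 2 = k % 2 := by
      rw [Int.not_odd_iff_even] at h
      obtain ⟨r, hr⟩ := h
      omega
    have := walk1_nat_le k n.natAbs h'
    rwa [walk1_natAbs, Nat.cast_natAbs, Int.cast_abs, sq_abs] at this

theorem walk1_ge (k : ℕ) (n : ℤ) (h : Even (k + n)) (hn : 2 * |(n : ℝ)| ≤ k + 1) :
    walk1Mode k * Real.exp (-(n : ℝ) ^ 2 / (2 * (k + 1)) - |(n : ℝ)| ^ 3 / (k + 1) ^ 2) ≤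
      walk1 k n := by
  have h' : n.natAbs % 2 = k % 2 := by
    obtain ⟨r, hr⟩ := h
    omega
  have hn' : 2 * n.natAbs ≤ k + 1 := by
    have : ((2 * n.natAbs : ℕ) : ℝ) ≤ ((k + 1 : ℕ) : ℝ) := by
      push_cast [Nat.cast_natAbs]; exact hn
    exact_mod_cast this
  have := walk1_nat_ge k n.natAbs h' hn'
  rwa [walk1_natAbs, Nat.cast_natAbs, Int.cast_abs, sq_abs] at this

/-! ### The planar walk as a product of two walks -/

theorem walkLaw4_succ_apply (k : ℕ) (x : ℤ × ℤ) :
    walkLaw4 (k + 1) x = ∑ e ∈ neighbors4, 4⁻¹ * walkLaw4 k (x - e) := by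
  -- Drawing the step first leaves a sum over four neighbours instead of over the whole lattice.
  have h : walkLaw4 (k + 1) = stepLaw4.bind fun e => (walkLaw4 k).map fun w => w + e := by
    simp only [walkLaw4, PMF.map, Function.comp_def]
    exact PMF.bind_comm _ _ _
  rw [h, PMF.bind_apply, tsum_eq_sum (s := neighbors4)]
  · refine Finset.sum_congr rfl fun e he => ?_
    congr 1
    · rw [stepLaw4, PMF.uniformOfFinset_apply_of_mem _ he]
      rfl
    · rw [PMF.map_apply, tsum_eq_single (x - e)]
      · simp
      · intro w hw
        rw [if_neg]
        rintro rfl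
        simp at hw
  · intro e he
    rw [stepLaw4, PMF.uniformOfFinset_apply_of_notMem _ he, zero_mul]

theorem stepProb4_succ (k : ℕ) (t s : ℤ) :
    stepProb4 (k + 1) t s = (stepProb4 k (t - 1) s + stepProb4 k (t + 1) s +
      stepProb4 k t (s - 1) + stepProb4 k t (s + 1)) / 4 := by
  simp only [stepProb4]
  rw [walkLaw4_succ_apply, ENNReal.toReal_sum]
  · simp [neighbors4, ENNReal.toReal_mul]
    ring
  · intro e _
    exact ENNReal.mul_ne_top (by simp) (PMF.apply_ne_top _ _)

/-- A step changes `t + s` and `t - s` by independent signs: the four neighbours are the four sign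
patterns. -/
theorem stepProb4_eq (k : ℕ) (t s : ℤ) :
    stepProb4 k t s = walk1 k (t + s) * walk1 k (t - s) := by
  induction k generalizing t s with
  | zero =>
    simp only [stepProb4, walkLaw4, PMF.pure_apply, walk1_zero, Prod.mk.injEq]
    by_cases h : t = 0 ∧ s = 0
    · obtain ⟨rfl, rfl⟩ := h; simp
    · rw [if_neg h]
      by_cases h1 : t + s = 0
      · rw [if_neg (by omega : ¬ t - s = 0)]; simp
      · rw [if_neg h1]; simp
  | succ k ih =>
    rw [stepProb4_succ, ih, ih, ih, ih, walk1_succ, walk1_succ]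
    rw [show t - 1 + s = t + s - 1 by ring, show t - 1 - s = t - s - 1 by ring,
      show t + 1 + s = t + s + 1 by ring, show t + 1 - s = t - s + 1 by ring,
      show t + (s - 1) = t + s - 1 by ring, show t - (s - 1) = t - s + 1 by ring,
      show t + (s + 1) = t + s + 1 by ring, show t - (s + 1) = t - s - 1 by ring]
    ring

theorem stepProb4_nonneg (k : ℕ) (t s : ℤ) : 0 ≤ stepProb4 k t s := ENNReal.toReal_nonneg

theorem stepProb4_eq_zero_of_odd (k : ℕ) (t s : ℤ) (h : Odd (k + (t + s))) :
    stepProb4 k t s = 0 := by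
  rw [stepProb4_eq, walk1_eq_zero_of_odd k _ h, zero_mul]

theorem stepProb4_le_mode (k : ℕ) (t s : ℤ) :
    stepProb4 k t s ≤
      walk1Mode k ^ 2 * Real.exp (-((t : ℝ) ^ 2 + (s : ℝ) ^ 2 - 1) / (k + 1)) := by
  rw [stepProb4_eq]
  refine (mul_le_mul (walk1_le k _) (walk1_le k _) (walk1_nonneg _ _)
    (mul_nonneg (walk1Mode_nonneg k) (Real.exp_pos _).le)).trans_eq ?_
  rw [mul_mul_mul_comm, ← sq, ← Real.exp_add]
  congr 2
  push_cast
  field_simp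
  ring

theorem stepProb4_ge_mode (k : ℕ) (t s : ℤ) (h : Even (k + (t + s)))
    (hn : 2 * (|(t : ℝ)| + |(s : ℝ)|) ≤ k + 1) :
    walk1Mode k ^ 2 * Real.exp (-((t : ℝ) ^ 2 + (s : ℝ) ^ 2) / (k + 1)
      - 2 * (|(t : ℝ)| + |(s : ℝ)|) ^ 3 / (k + 1) ^ 2) ≤ stepProb4 k t s := by
  have h1 : |((t + s : ℤ) : ℝ)| ≤ |(t : ℝ)| + |(s : ℝ)| := by push_cast; exact abs_add_le _ _
  have h2 : |((t - s : ℤ) : ℝ)| ≤ |(t : ℝ)| + |(s : ℝ)| := by push_cast; exact abs_sub _ _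
  have e2 : Even ((k : ℤ) + (t - s)) := by
    obtain ⟨r, hr⟩ := h; exact ⟨r - s, by linarith⟩
  have a1 := walk1_ge k (t + s) h (by linarith)
  have a2 := walk1_ge k (t - s) e2 (by linarith)
  rw [stepProb4_eq]
  refine le_trans ?_ (mul_le_mul a1 a2 (mul_nonneg (walk1Mode_nonneg k) (Real.exp_pos _).le)
    (walk1_nonneg _ _))
  rw [mul_mul_mul_comm, ← sq, ← Real.exp_add]
  refine mul_le_mul_of_nonneg_left (Real.exp_le_exp.mpr ?_) (sq_nonneg _)
  have b1 : |((t + s : ℤ) : ℝ)| ^ 3 / ((k : ℝ) + 1) ^ 2 ≤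
      (|(t : ℝ)| + |(s : ℝ)|) ^ 3 / (k + 1) ^ 2 := by gcongr
  have b2 : |((t - s : ℤ) : ℝ)| ^ 3 / ((k : ℝ) + 1) ^ 2 ≤
      (|(t : ℝ)| + |(s : ℝ)|) ^ 3 / (k + 1) ^ 2 := by gcongr
  have e : -((t + s : ℤ) : ℝ) ^ 2 / (2 * ((k : ℝ) + 1)) + -((t - s : ℤ) : ℝ) ^ 2 / (2 * (k + 1))
      = -((t : ℝ) ^ 2 + (s : ℝ) ^ 2) / (k + 1) := by
    push_cast; field_simp; ring
  rw [← e, mul_div_assoc]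
  linarith

theorem walk1Mode_sq_le (k : ℕ) : walk1Mode k ^ 2 ≤ 2 / (k + 1) := by
  have h := (walk1Mode_bounds k).2
  have hk : (0 : ℝ) < k + 1 := by positivity
  have h2 : ((k : ℝ) + 2) / (k + 1) ≤ 2 := by
    rw [div_le_iff₀ hk]; linarith [(k.cast_nonneg : (0 : ℝ) ≤ k)]
  rw [le_div_iff₀ hk]
  nlinarith [Real.pi_gt_three, mul_nonneg hk.le (sq_nonneg (walk1Mode k))]

/-- Gaussian upper bound for the transition probabilities, with the sharp exponent. -/
theorem stepProb4_le (k : ℕ) (t s : ℤ) :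
    stepProb4 k t s ≤
      6 / (k + 1) * Real.exp (-((t : ℝ) ^ 2 + (s : ℝ) ^ 2) / (k + 1)) := by
  have hk : (0 : ℝ) < k + 1 := by positivity
  have hk1 : 1 / ((k : ℝ) + 1) ≤ 1 := by
    rw [div_le_one hk]; linarith [(k.cast_nonneg : (0 : ℝ) ≤ k)]
  refine (stepProb4_le_mode k t s).trans ?_
  have e : -((t : ℝ) ^ 2 + (s : ℝ) ^ 2 - 1) / ((k : ℝ) + 1) =
      1 / (k + 1) + -((t : ℝ) ^ 2 + (s : ℝ) ^ 2) / (k + 1) := by ring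
  rw [e, Real.exp_add, ← mul_assoc]
  refine mul_le_mul_of_nonneg_right ?_ (Real.exp_pos _).le
  have h3 : Real.exp (1 / ((k : ℝ) + 1)) ≤ 3 :=
    (Real.exp_le_exp.mpr hk1).trans (Real.exp_one_lt_d9.le.trans (by norm_num))
  refine (mul_le_mul (walk1Mode_sq_le k) h3 (Real.exp_pos _).le (by positivity)).trans_eq ?_
  ring

/-! ### The Bessel integral -/

/-- The density `exp (-w u - R / u) / u`, whose integral over `u > 0` is a multiple of `K₀`. -/
noncomputable def besselKernel (w R u : ℝ) : ℝ := Real.exp (-w * u - R / u) / u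

theorem besselKernel_nonneg (w R : ℝ) {u : ℝ} (hu : 0 ≤ u) : 0 ≤ besselKernel w R u :=
  div_nonneg (Real.exp_pos _).le hu

theorem integrable_exp_neg_mul_cosh {x : ℝ} (hx : 0 < x) :
    Integrable fun y : ℝ => Real.exp (-x * Real.cosh y) := by
  have h := integrableOn_besselK0 hx
  have h2 : IntegrableOn (fun y : ℝ => Real.exp (-x * Real.cosh y)) (Set.Iic 0) := by
    rw [integrableOn_Iic_iff_integrableOn_Iio]
    have := IntegrableOn.comp_neg_Iio (c := (0 : ℝ)) (by simpa using h)
    simpa [Real.cosh_neg] using this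
  rw [← integrableOn_univ, ← Set.Iic_union_Ioi (a := (0 : ℝ))]
  exact h2.union h

theorem integral_exp_neg_mul_cosh (x : ℝ) :
    ∫ y : ℝ, Real.exp (-x * Real.cosh y) = 2 * besselK0 x := by
  have := integral_comp_abs (f := fun y : ℝ => Real.exp (-x * Real.cosh y))
  simpa [Real.cosh_abs, besselK0] using this

theorem image_mul_exp_univ {a : ℝ} (ha : 0 < a) :
    (fun y : ℝ => a * Real.exp y) '' Set.univ = Set.Ioi 0 := by
  ext u
  simp only [Set.image_univ, Set.mem_range, Set.mem_Ioi]
  constructor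
  · rintro ⟨y, rfl⟩; positivity
  · intro hu
    refine ⟨Real.log (u / a), ?_⟩
    rw [Real.exp_log (by positivity)]
    field_simp

/-- For `u = (b / a) e^y` one has `a² u + b² / u = 2ab cosh y`, and the Jacobian `u` cancels the
factor `1 / u`. -/
theorem mul_besselKernel_mul_exp {a b : ℝ} (ha : 0 < a) (hb : 0 < b) (y : ℝ) :
    |b / a * Real.exp y| • besselKernel (a ^ 2) (b ^ 2) (b / a * Real.exp y) =
      Real.exp (-(2 * (a * b)) * Real.cosh y) := by
  have hp : 0 < b / a * Real.exp y := by positivity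
  rw [abs_of_pos hp, smul_eq_mul, besselKernel, mul_div_cancel₀ _ hp.ne', Real.cosh_eq,
    Real.exp_neg]
  congr 1
  have := Real.exp_pos y
  field_simp
  ring

theorem integrableOn_besselKernel {w R : ℝ} (hw : 0 < w) (hR : 0 < R) :
    IntegrableOn (besselKernel w R) (Set.Ioi 0) := by
  obtain ⟨a, ha, rfl⟩ : ∃ a : ℝ, 0 < a ∧ a ^ 2 = w := ⟨√w, by positivity, Real.sq_sqrt hw.le⟩
  obtain ⟨b, hb, rfl⟩ : ∃ b : ℝ, 0 < b ∧ b ^ 2 = R := ⟨√R, by positivity, Real.sq_sqrt hR.le⟩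
  have hba : 0 < b / a := by positivity
  rw [← image_mul_exp_univ hba, integrableOn_image_iff_integrableOn_abs_deriv_smul
    MeasurableSet.univ
    (fun y _ => ((Real.hasDerivAt_exp y).const_mul (b / a)).hasDerivWithinAt)
    (fun x _ y _ hxy => Real.exp_injective (mul_left_cancel₀ hba.ne' hxy)), integrableOn_univ]
  simp_rw [mul_besselKernel_mul_exp ha hb]
  exact integrable_exp_neg_mul_cosh (by positivity)

theorem integral_besselKernel {w R : ℝ} (hw : 0 < w) (hR : 0 < R) :
    ∫ u in Set.Ioi (0 : ℝ), besselKernel w R u = 2 * besselK0 (2 * √(w * R)) := by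
  obtain ⟨a, ha, rfl⟩ : ∃ a : ℝ, 0 < a ∧ a ^ 2 = w := ⟨√w, by positivity, Real.sq_sqrt hw.le⟩
  obtain ⟨b, hb, rfl⟩ : ∃ b : ℝ, 0 < b ∧ b ^ 2 = R := ⟨√R, by positivity, Real.sq_sqrt hR.le⟩
  have hba : 0 < b / a := by positivity
  rw [← image_mul_exp_univ hba, integral_image_eq_integral_abs_deriv_smul
    MeasurableSet.univ
    (fun y _ => ((Real.hasDerivAt_exp y).const_mul (b / a)).hasDerivWithinAt)
    (fun x _ y _ hxy => Real.exp_injective (mul_left_cancel₀ hba.ne' hxy))]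
  simp_rw [mul_besselKernel_mul_exp ha hb]
  rw [setIntegral_univ, integral_exp_neg_mul_cosh, ← mul_pow, Real.sqrt_sq (by positivity)]

theorem besselK0_nonneg (x : ℝ) : 0 ≤ besselK0 x :=
  integral_nonneg fun _ => (Real.exp_pos _).le

theorem continuousAt_besselK0 {x : ℝ} (hx : 0 < x) : ContinuousAt besselK0 x := by
  refine continuousAt_of_dominated (bound := fun u => Real.exp (-(x / 2) * Real.cosh u))
    (Eventually.of_forall fun y => by fun_prop) ?_ (integrableOn_besselK0 (half_pos hx))
    (ae_of_all _ fun u => by fun_prop)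
  filter_upwards [lt_mem_nhds (half_lt_self hx)] with y hy
  refine ae_of_all _ fun u => ?_
  rw [Real.norm_eq_abs, abs_of_pos (Real.exp_pos _)]
  apply Real.exp_le_exp.mpr
  nlinarith [Real.cosh_pos u]

theorem sq_add_sq_pos_of_ne {t s : ℝ} (h : (t, s) ≠ (0, 0)) : 0 < t ^ 2 + s ^ 2 := by
  rcases eq_or_ne t 0 with rfl | ht
  · have : s ≠ 0 := by rintro rfl; exact h rfl
    positivity
  · positivity

theorem h4_nonneg (t s z : ℝ) : 0 ≤ h4 t s z :=
  mul_nonneg (by positivity) (besselK0_nonneg _)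

theorem continuousAt_h4 {t s z : ℝ} (h : (t, s) ≠ (0, 0)) (hz : 0 < z) :
    ContinuousAt (fun p : ℝ × ℝ × ℝ => h4 p.1 p.2.1 p.2.2) (t, s, z) := by
  have hp := sq_add_sq_pos_of_ne h
  have h1 : ContinuousAt besselK0 (2 * √(z * (t ^ 2 + s ^ 2))) :=
    continuousAt_besselK0 (by positivity)
  have h2 : ContinuousAt (fun p : ℝ × ℝ × ℝ => 2 * √(p.2.2 * (p.1 ^ 2 + p.2.1 ^ 2))) (t, s, z) := by
    fun_prop
  exact (ContinuousAt.comp (f := fun p : ℝ × ℝ × ℝ => 2 * √(p.2.2 * (p.1 ^ 2 + p.2.1 ^ 2)))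
    h1 h2).const_mul (2 / Real.pi)

theorem h4_eq_integral {t s z : ℝ} (h : (t, s) ≠ (0, 0)) (hz : 0 < z) :
    h4 t s z = ∫ u in Set.Ioi (0 : ℝ), 1 / Real.pi * besselKernel z (t ^ 2 + s ^ 2) u := by
  rw [integral_const_mul, integral_besselKernel hz (sq_add_sq_pos_of_ne h), h4]
  ring

/-! ### The dominating bound -/

/-- The term at `k + 1` is compared with the integral over `[k + 1, k + 2]`. There `exp (-w u)`
falls by at most a factor `e` because `w ≤ 1`, `1 / u` by at most `2`, and `exp (-R / u)` increases.
-/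
theorem sum_besselKernel_le {w R : ℝ} (hw : 0 < w) (hw1 : w ≤ 1) (hR : 0 < R) (n : ℕ) :
    ∑ k ∈ Finset.range n, besselKernel w R (k + 1) ≤
      2 * Real.exp 1 * ∫ u in Set.Ioi (0 : ℝ), besselKernel w R u := by
  have hi := integrableOn_besselKernel hw hR
  have hint : ∀ k : ℕ, IntervalIntegrable (besselKernel w R) volume (k + 1 : ℕ) (k + 1 + 1 : ℕ) := by
    intro k
    rw [intervalIntegrable_iff_integrableOn_Ioc_of_le (by push_cast; linarith)]
    refine hi.mono_set fun u hu => ?_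
    exact lt_of_le_of_lt (Nat.cast_nonneg _) hu.1
  have hterm : ∀ k : ℕ, besselKernel w R (k + 1) ≤
      2 * Real.exp 1 * ∫ u in ((k + 1 : ℕ) : ℝ)..(k + 1 + 1 : ℕ), besselKernel w R u := by
    intro k
    rw [← intervalIntegral.integral_const_mul]
    have hc : ∫ u in ((k + 1 : ℕ) : ℝ)..(k + 1 + 1 : ℕ), besselKernel w R (k + 1) =
        besselKernel w R (k + 1) := by
      rw [intervalIntegral.integral_const]; push_cast; simp
    rw [← hc]
    apply intervalIntegral.integral_mono_on (by push_cast; linarith)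
      intervalIntegrable_const ((hint k).const_mul _)
    intro u hu
    push_cast at hu
    obtain ⟨hu1, hu2⟩ := hu
    have hk : (0 : ℝ) ≤ k := k.cast_nonneg
    have hu0 : 0 < u := by linarith
    rw [besselKernel, besselKernel, mul_div_assoc', div_le_div_iff₀ (by positivity) hu0]
    have h1 : Real.exp (-w * (k + 1) - R / (k + 1)) ≤
        Real.exp 1 * Real.exp (-w * u - R / u) := by
      rw [← Real.exp_add]
      apply Real.exp_le_exp.mpr
      have : R / u ≤ R / (k + 1) := by gcongr
      nlinarith
    have h2 : u ≤ 2 * (k + 1) := by linarith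
    calc _ ≤ Real.exp 1 * Real.exp (-w * u - R / u) * (2 * (k + 1)) := by gcongr
      _ = _ := by ring
  calc ∑ k ∈ Finset.range n, besselKernel w R (k + 1)
      ≤ ∑ k ∈ Finset.range n,
          2 * Real.exp 1 * ∫ u in ((k + 1 : ℕ) : ℝ)..(k + 1 + 1 : ℕ), besselKernel w R u :=
        Finset.sum_le_sum fun k _ => hterm k
    _ = 2 * Real.exp 1 * ∫ u in ((0 + 1 : ℕ) : ℝ)..(n + 1 : ℕ), besselKernel w R u := by
        rw [← Finset.mul_sum, intervalIntegral.sum_integral_adjacent_intervals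
          (a := fun k : ℕ => ((k + 1 : ℕ) : ℝ)) fun k _ => hint k]
    _ ≤ _ := by
        refine mul_le_mul_of_nonneg_left ?_ (by positivity)
        rw [intervalIntegral.integral_of_le (by push_cast; simp)]
        refine setIntegral_mono_set hi ?_ ?_
        · exact (ae_restrict_iff' measurableSet_Ioi).mpr
            (ae_of_all _ fun u hu => besselKernel_nonneg w R (le_of_lt hu))
        · refine LE.le.eventuallyLE fun u hu => ?_
          exact lt_of_le_of_lt (Nat.cast_nonneg _) hu.1

theorem sq_le_floor_sq (x : ℝ) : x ^ 2 ≤ (⌊x⌋ : ℝ) ^ 2 + 2 * |(⌊x⌋ : ℝ)| + 1 := by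
  have h1 := Int.floor_le x
  have h2 := Int.lt_floor_add_one x
  nlinarith [le_abs_self (⌊x⌋ : ℝ), neg_abs_le (⌊x⌋ : ℝ)]

theorem one_sub_pow_le_exp {w : ℝ} (hw1 : w ≤ 1) (k : ℕ) :
    (1 - w) ^ k ≤ Real.exp (-w * k) := by
  rw [mul_comm, Real.exp_nat_mul]
  exact pow_le_pow_left₀ (by linarith) (Real.one_sub_le_exp_neg w) k

/-- If `|n| + |m| ≤ k + 1`, replacing the integer parts by `x`, `y` changes the squared norm by at
most `4 (k + 1)`, a factor `e^4`; another `e` pays for `k + 1` in place of `k`. -/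
theorem one_sub_pow_mul_stepProb4_le {w : ℝ} (hw : 0 < w) (hw1 : w ≤ 1) (x y : ℝ) (k : ℕ) :
    (1 - w) ^ k * stepProb4 k ⌊x⌋ ⌊y⌋ ≤
      6 * Real.exp 5 * besselKernel w (x ^ 2 + y ^ 2) (k + 1) +
        6 * Real.exp (-(|(⌊x⌋ : ℝ)| + |(⌊y⌋ : ℝ)|) / 4) * Real.exp (-1 / 4) ^ k := by
  have hk : (1 : ℝ) ≤ k + 1 := by linarith [(k.cast_nonneg : (0 : ℝ) ≤ k)]
  have hk0 : (0 : ℝ) < k + 1 := by linarith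
  have hx := sq_le_floor_sq x
  have hy := sq_le_floor_sq y
  have hp := stepProb4_le k ⌊x⌋ ⌊y⌋
  set n : ℝ := (⌊x⌋ : ℝ)
  set m : ℝ := (⌊y⌋ : ℝ)
  have hA : 0 ≤ 6 * Real.exp 5 * besselKernel w (x ^ 2 + y ^ 2) (k + 1) :=
    mul_nonneg (by positivity) (besselKernel_nonneg _ _ hk0.le)
  have hB : 0 ≤ 6 * Real.exp (-(|n| + |m|) / 4) * Real.exp (-1 / 4) ^ k := by positivity
  rcases le_or_gt (|n| + |m|) ((k : ℝ) + 1) with h | h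
  · refine le_trans ?_ (le_add_of_nonneg_right hB)
    have h1 : (1 - w) ^ k ≤ Real.exp (1 - w * (k + 1)) :=
      (one_sub_pow_le_exp hw1 k).trans (Real.exp_le_exp.mpr (by linarith))
    have h2 : Real.exp (-(n ^ 2 + m ^ 2) / (k + 1)) ≤
        Real.exp (4 - (x ^ 2 + y ^ 2) / (k + 1)) := by
      apply Real.exp_le_exp.mpr
      rw [le_sub_iff_add_le, ← add_div, div_le_iff₀ hk0]
      linarith
    calc (1 - w) ^ k * stepProb4 k ⌊x⌋ ⌊y⌋
        ≤ Real.exp (1 - w * (k + 1)) *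
            (6 / (k + 1) * Real.exp (4 - (x ^ 2 + y ^ 2) / (k + 1))) := by
          refine mul_le_mul h1 (hp.trans ?_) (stepProb4_nonneg _ _ _) (Real.exp_pos _).le
          gcongr
      _ = 6 / (k + 1) * (Real.exp (1 - w * (k + 1)) *
            Real.exp (4 - (x ^ 2 + y ^ 2) / (k + 1))) := by ring
      _ = 6 / (k + 1) * (Real.exp 5 *
            Real.exp (-w * (k + 1) - (x ^ 2 + y ^ 2) / (k + 1))) := by
          rw [← Real.exp_add, ← Real.exp_add]; congr 2; ring
      _ = _ := by rw [besselKernel]; ring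
  · refine le_trans ?_ (le_add_of_nonneg_left hA)
    have h1 : (1 - w) ^ k ≤ 1 := pow_le_one₀ (by linarith) (by linarith)
    -- With `L = |n| + |m| > k + 1`, the quotient `(n² + m²) / (k + 1)` is at least `L² / (2 (k +
    -- 1)) ≥ L / 2`. Half of this is kept as `L / 4`; the other half exceeds `k / 4` and makes the
    -- sum over `k` geometric.
    have h2 : -(n ^ 2 + m ^ 2) / ((k : ℝ) + 1) ≤ -(|n| + |m|) / 4 + k * (-1 / 4) := by
      rw [div_le_iff₀ hk0]
      have hL : (|n| + |m|) ^ 2 ≤ 2 * (n ^ 2 + m ^ 2) := by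
        nlinarith [sq_nonneg (|n| - |m|), sq_abs n, sq_abs m]
      nlinarith
    have h3 : 6 / ((k : ℝ) + 1) ≤ 6 := div_le_self (by norm_num) hk
    calc (1 - w) ^ k * stepProb4 k ⌊x⌋ ⌊y⌋ ≤ 1 * stepProb4 k ⌊x⌋ ⌊y⌋ :=
          mul_le_mul_of_nonneg_right h1 (stepProb4_nonneg _ _ _)
      _ ≤ 6 * Real.exp (-(|n| + |m|) / 4 + k * (-1 / 4)) := by
          rw [one_mul]
          refine hp.trans ?_
          gcongr
      _ = _ := by rw [Real.exp_add, Real.exp_nat_mul]; ring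

theorem exp_neg_floor_le (x y : ℝ) :
    Real.exp (-(|(⌊x⌋ : ℝ)| + |(⌊y⌋ : ℝ)|) / 4) ≤
      Real.exp 1 * Real.exp (-(1 / 2) * (√|x| + √|y|)) := by
  have key : ∀ x : ℝ, √|x| ≤ (|(⌊x⌋ : ℝ)| + 2) / 2 := by
    intro x
    have h1 : √|x| ≤ (|x| + 1) / 2 := by
      nlinarith [sq_nonneg (√|x| - 1), Real.sq_sqrt (abs_nonneg x)]
    have h2 : |x| ≤ |(⌊x⌋ : ℝ)| + 1 := by
      have := abs_add_le (⌊x⌋ : ℝ) (Int.fract x)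
      rw [Int.floor_add_fract, abs_of_nonneg (Int.fract_nonneg x)] at this
      linarith [Int.fract_lt_one x]
    linarith
  rw [← Real.exp_add]
  apply Real.exp_le_exp.mpr
  linarith [key x, key y]

theorem exists_green4_floor_le : ∃ C : ℝ, 0 < C ∧ ∀ w x y : ℝ, 0 < w → w < 1 →
    (x, y) ≠ (0, 0) → green4 ⌊x⌋ ⌊y⌋ (1 - w) ≤
      C * (h4 x y w + Real.exp (-(1 / 2) * (√|x| + √|y|))) := by
  have hgeo : Summable fun k : ℕ => Real.exp (-1 / 4) ^ k :=
    summable_geometric_of_lt_one (Real.exp_pos _).le 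
    ((Real.exp_lt_exp.mpr (by norm_num)).trans_eq Real.exp_zero)
  set S := ∑' k : ℕ, Real.exp (-1 / 4) ^ k with hS
  have hS0 : 0 ≤ S := tsum_nonneg fun k => by positivity
  have hpi := Real.pi_pos
  refine ⟨12 * Real.exp 6 * Real.pi + 6 * Real.exp 1 * S, by positivity, ?_⟩
  intro w x y hw hw1 hxy
  have hr := sq_add_sq_pos_of_ne hxy
  set E := Real.exp (-(1 / 2) * (√|x| + √|y|))
  have hE : 0 < E := Real.exp_pos _
  have hh := h4_nonneg x y w
  have hJ : ∫ u in Set.Ioi (0 : ℝ), besselKernel w (x ^ 2 + y ^ 2) u = Real.pi * h4 x y w := by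
    rw [integral_besselKernel hw hr, h4]; field_simp
  have hmain : green4 ⌊x⌋ ⌊y⌋ (1 - w) ≤
      12 * Real.exp 6 * Real.pi * h4 x y w + 6 * Real.exp 1 * S * E := by
    refine Real.tsum_le_of_sum_range_le
      (fun k => mul_nonneg (pow_nonneg (by linarith) k) (stepProb4_nonneg _ _ _)) fun n => ?_
    refine (Finset.sum_le_sum fun k _ =>
      one_sub_pow_mul_stepProb4_le hw hw1.le x y k).trans ?_
    rw [Finset.sum_add_distrib, ← Finset.mul_sum, ← Finset.mul_sum]
    have h1 := sum_besselKernel_le hw hw1.le hr n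
    rw [hJ] at h1
    have h2 : ∑ k ∈ Finset.range n, Real.exp (-1 / 4) ^ k ≤ S :=
      hgeo.sum_le_tsum _ fun k _ => by positivity
    have h3 := exp_neg_floor_le x y
    refine add_le_add ?_ ?_
    · refine (mul_le_mul_of_nonneg_left h1 (by positivity)).trans_eq ?_
      rw [show (6 : ℝ) = 5 + 1 by norm_num, Real.exp_add]; ring
    · calc _ ≤ 6 * (Real.exp 1 * E) * S := by gcongr
        _ = _ := by ring
  refine hmain.trans ?_
  rw [mul_add, add_mul, add_mul]
  have a1 : 0 ≤ 6 * Real.exp 1 * S * h4 x y w := by positivity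
  have a2 : 0 ≤ 12 * Real.exp 6 * Real.pi * E := by positivity
  linarith

theorem h4_scale {l : ℝ} (hl : 0 < l) (t s z : ℝ) :
    h4 (l * t) (l * s) (z / l ^ 2) = h4 t s z := by
  rw [h4, h4]
  congr 4
  field_simp

theorem green4_dominated : ∃ C c : ℝ, 0 < C ∧ 0 < c ∧ ∀ᶠ l : ℝ in atTop, ∀ t s z : ℝ,
    (t, s) ≠ (0, 0) → 0 < z → z < l ^ 2 →
    green4 ⌊l * t⌋ ⌊l * s⌋ (1 - z / l ^ 2) <
      C * (h4 t s z + Real.exp (-c * Real.sqrt l * (|t| ^ (1 / 2 : ℝ) + |s| ^ (1 / 2 : ℝ)))) := by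
  obtain ⟨C, hC, h⟩ := exists_green4_floor_le
  -- Taking `C + 1` makes the inequality strict, the right-hand bracket being positive.
  refine ⟨C + 1, 1 / 2, by linarith, by norm_num, ?_⟩
  filter_upwards [eventually_gt_atTop 0] with l hl t s z hts hz hzl
  have hne : (l * t, l * s) ≠ (0, 0) := by
    intro h0
    apply hts
    simpa [hl.ne'] using h0
  have := h (z / l ^ 2) (l * t) (l * s) (by positivity) ((div_lt_one (by positivity)).mpr hzl) hne
  rw [h4_scale hl] at this
  refine this.trans_lt ?_
  have e : -(1 / 2) * (√|l * t| + √|l * s|) =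
      -(1 / 2) * √l * (|t| ^ (1 / 2 : ℝ) + |s| ^ (1 / 2 : ℝ)) := by
    rw [abs_mul, abs_mul, abs_of_pos hl, Real.sqrt_mul hl.le, Real.sqrt_mul hl.le,
      Real.sqrt_eq_rpow |t|, Real.sqrt_eq_rpow |s|]
    ring
  rw [e]
  have h0 := h4_nonneg t s z
  exact mul_lt_mul_of_pos_right (by linarith) (by positivity)

/-! ### Local limit theorem -/

section LocalLimit

variable {ι : Type*} {F : Filter ι} {l w : ι → ℝ} {k : ι → ℕ} {n m : ι → ℤ} {t s z v : ℝ}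

theorem tendsto_add_one_atTop_of_div_sq (hl : Tendsto l F atTop) (hv : 0 < v)
    (hk : Tendsto (fun i => ((k i : ℝ) + 1) / l i ^ 2) F (𝓝 v)) :
    Tendsto (fun i => (k i : ℝ) + 1) F atTop := by
  have h : Tendsto (fun i => ((k i : ℝ) + 1) / l i ^ 2 * l i ^ 2) F atTop :=
    hk.pos_mul_atTop hv ((tendsto_pow_atTop two_ne_zero).comp hl)
  refine h.congr' ?_
  filter_upwards [hl.eventually_gt_atTop 0] with i hi
  field_simp

theorem tendsto_one_sub_pow (hl : Tendsto l F atTop)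
    (hk : Tendsto (fun i => ((k i : ℝ) + 1) / l i ^ 2) F (𝓝 v))
    (hw : Tendsto (fun i => w i * l i ^ 2) F (𝓝 z)) :
    Tendsto (fun i => (1 - w i) ^ k i) F (𝓝 (Real.exp (-z * v))) := by
  have hl2 : Tendsto (fun i => (l i ^ 2)⁻¹) F (𝓝 0) :=
    tendsto_inv_atTop_zero.comp ((tendsto_pow_atTop two_ne_zero).comp hl)
  have hw0 : Tendsto w F (𝓝 0) := by
    have := hw.mul hl2
    rw [mul_zero] at this
    refine this.congr' ?_
    filter_upwards [hl.eventually_gt_atTop 0] with i hi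
    field_simp
  have hwk : Tendsto (fun i => w i * k i) F (𝓝 (z * v)) := by
    have := (hw.mul hk).sub hw0
    rw [sub_zero] at this
    refine this.congr' ?_
    filter_upwards [hl.eventually_gt_atTop 0] with i hi
    field_simp
    ring
  have hup : Tendsto (fun i => Real.exp (-w i * k i)) F (𝓝 (Real.exp (-z * v))) := by
    refine (Real.continuous_exp.tendsto _).comp ?_
    simpa only [neg_mul] using hwk.neg
  have hlo : Tendsto (fun i => Real.exp (-(w i * k i) - 2 * (w i * (w i * k i)))) F
      (𝓝 (Real.exp (-z * v))) := by
    refine (Real.continuous_exp.tendsto _).comp ?_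
    have := hwk.neg.sub ((hw0.mul hwk).const_mul 2)
    simpa only [neg_mul, zero_mul, mul_zero, sub_zero] using this
  have hhalf : ∀ᶠ i in F, w i < 1 / 2 := hw0.eventually (gt_mem_nhds (by norm_num))
  refine tendsto_of_tendsto_of_tendsto_of_le_of_le' hlo hup ?_ ?_
  · filter_upwards [hhalf] with i hi
    have := pow_le_pow_left₀ (Real.exp_pos _).le (exp_neg_le_one_sub hi.le) (k i)
    rw [← Real.exp_nat_mul] at this
    refine le_trans (le_of_eq ?_) this
    congr 1; ring
  · filter_upwards [hhalf] with i hi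
    exact one_sub_pow_le_exp (by linarith) _

theorem tendsto_walk1Mode_sq :
    Tendsto (fun k : ℕ => ((k : ℝ) + 1) * walk1Mode k ^ 2) atTop (𝓝 (2 / Real.pi)) := by
  have hpi := Real.pi_pos
  have h0 : Tendsto (fun k : ℕ => 1 / ((k : ℝ) + 1)) atTop (𝓝 0) :=
    tendsto_one_div_add_atTop_nhds_zero_nat
  have h1 : Tendsto (fun k : ℕ => ((k : ℝ) + 1) / (k + 2)) atTop (𝓝 1) := by
    have := (h0.const_add 1).inv₀ (by norm_num)
    simp only [add_zero, inv_one] at this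
    refine this.congr fun k => ?_
    field_simp
    ring
  have h2 : Tendsto (fun k : ℕ => ((k : ℝ) + 2) / (k + 1)) atTop (𝓝 1) := by
    have := h0.const_add 1
    simp only [add_zero] at this
    refine this.congr fun k => ?_
    field_simp
    ring
  have h := (tendsto_of_tendsto_of_tendsto_of_le_of_le h1 h2
    (fun k => (walk1Mode_bounds k).1) fun k => (walk1Mode_bounds k).2).const_mul (2 / Real.pi)
  rw [mul_one] at h
  refine h.congr fun k => ?_
  field_simp

/-- Local limit theorem for the planar walk, on the parity class of the end point. -/
theorem tendsto_sq_mul_stepProb4 (hl : Tendsto l F atTop) (hv : 0 < v)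
    (hk : Tendsto (fun i => ((k i : ℝ) + 1) / l i ^ 2) F (𝓝 v))
    (hn : Tendsto (fun i => (n i : ℝ) / l i) F (𝓝 t))
    (hm : Tendsto (fun i => (m i : ℝ) / l i) F (𝓝 s))
    (heven : ∀ i, Even (k i + (n i + m i))) :
    Tendsto (fun i => l i ^ 2 / 2 * stepProb4 (k i) (n i) (m i)) F
      (𝓝 (1 / Real.pi / v * Real.exp (-(t ^ 2 + s ^ 2) / v))) := by
  have hl0 := hl.eventually_gt_atTop 0
  have hlinv : Tendsto (fun i => (l i)⁻¹) F (𝓝 0) := tendsto_inv_atTop_zero.comp hl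
  have hK := tendsto_add_one_atTop_of_div_sq hl hv hk
  have hkN : Tendsto k F atTop := by
    rw [← tendsto_natCast_atTop_iff (R := ℝ)]
    have := tendsto_atTop_add_const_right F (-1 : ℝ) hK
    simpa using this
  have hpre : Tendsto (fun i => l i ^ 2 / 2 * walk1Mode (k i) ^ 2) F (𝓝 (1 / Real.pi / v)) := by
    -- The factor `1/2` is the density of the parity class among all times.
    have := ((tendsto_walk1Mode_sq.comp hkN).div hk hv.ne').const_mul (1 / 2)
    rw [show 1 / 2 * (2 / Real.pi / v) = 1 / Real.pi / v by ring] at this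
    refine this.congr' ?_
    filter_upwards [hl0] with i hi
    have : (k i : ℝ) + 1 ≠ 0 := by positivity
    simp only [Function.comp, Pi.div_apply]
    field_simp
  have hG : Tendsto (fun i => -((n i : ℝ) ^ 2 + (m i : ℝ) ^ 2) / ((k i : ℝ) + 1)) F
      (𝓝 (-(t ^ 2 + s ^ 2) / v)) := by
    have := (((hn.pow 2).add (hm.pow 2)).neg).div hk hv.ne'
    refine this.congr' ?_
    filter_upwards [hl0] with i hi
    have : (k i : ℝ) + 1 ≠ 0 := by positivity
    simp only [Pi.div_apply]
    field_simp
  have hA : Tendsto (fun i => |(n i : ℝ)| / l i + |(m i : ℝ)| / l i) F (𝓝 (|t| + |s|)) := by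
    refine (hn.abs.add hm.abs).congr' ?_
    filter_upwards [hl0] with i hi
    rw [abs_div, abs_div, abs_of_pos hi]
  have herr : Tendsto (fun i => 2 * (|(n i : ℝ)| + |(m i : ℝ)|) ^ 3 / ((k i : ℝ) + 1) ^ 2) F
      (𝓝 0) := by
    -- The cubic error is of order `l³ / l⁴ = 1 / l`.
    have := ((((hA.pow 3).const_mul 2).div (hk.pow 2) (by positivity)).mul hlinv)
    rw [mul_zero] at this
    refine this.congr' ?_
    filter_upwards [hl0] with i hi
    have : (k i : ℝ) + 1 ≠ 0 := by positivity
    simp only [Pi.div_apply]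
    field_simp
  have hone : Tendsto (fun i => 1 / ((k i : ℝ) + 1)) F (𝓝 0) := by
    simp only [one_div]
    exact tendsto_inv_atTop_zero.comp hK
  have hsmall : ∀ᶠ i in F, 2 * (|(n i : ℝ)| + |(m i : ℝ)|) ≤ k i + 1 := by
    have h0 : Tendsto (fun i => (l i)⁻¹ * (2 * (|(n i : ℝ)| / l i + |(m i : ℝ)| / l i))) F
        (𝓝 0) := by
      have := hlinv.mul (hA.const_mul 2)
      rwa [zero_mul] at this
    filter_upwards [hl0, h0.eventually_lt hk hv] with i hi h
    rw [lt_div_iff₀ (by positivity)] at h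
    refine le_trans (le_of_eq ?_) h.le
    field_simp
  have hlo : Tendsto (fun i => l i ^ 2 / 2 * walk1Mode (k i) ^ 2 *
      Real.exp (-((n i : ℝ) ^ 2 + (m i : ℝ) ^ 2) / ((k i : ℝ) + 1) -
        2 * (|(n i : ℝ)| + |(m i : ℝ)|) ^ 3 / ((k i : ℝ) + 1) ^ 2)) F
      (𝓝 (1 / Real.pi / v * Real.exp (-(t ^ 2 + s ^ 2) / v))) := by
    have := (hG.sub herr)
    rw [sub_zero] at this
    exact hpre.mul ((Real.continuous_exp.tendsto _).comp this)
  have hup : Tendsto (fun i => l i ^ 2 / 2 * walk1Mode (k i) ^ 2 *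
      Real.exp (-((n i : ℝ) ^ 2 + (m i : ℝ) ^ 2) / ((k i : ℝ) + 1) + 1 / ((k i : ℝ) + 1))) F
      (𝓝 (1 / Real.pi / v * Real.exp (-(t ^ 2 + s ^ 2) / v))) := by
    have := (hG.add hone)
    rw [add_zero] at this
    exact hpre.mul ((Real.continuous_exp.tendsto _).comp this)
  refine tendsto_of_tendsto_of_tendsto_of_le_of_le' hlo hup ?_ ?_
  · filter_upwards [hsmall] with i hi
    rw [mul_assoc]
    exact mul_le_mul_of_nonneg_left (stepProb4_ge_mode _ _ _ (heven i) hi) (by positivity)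
  · refine Eventually.of_forall fun i => ?_
    rw [mul_assoc]
    refine mul_le_mul_of_nonneg_left ((stepProb4_le_mode _ _ _).trans_eq ?_) (by positivity)
    congr 2
    ring

theorem tendsto_sq_mul_one_sub_pow_mul_stepProb4 (hl : Tendsto l F atTop) (hv : 0 < v)
    (hk : Tendsto (fun i => ((k i : ℝ) + 1) / l i ^ 2) F (𝓝 v))
    (hw : Tendsto (fun i => w i * l i ^ 2) F (𝓝 z))
    (hn : Tendsto (fun i => (n i : ℝ) / l i) F (𝓝 t))
    (hm : Tendsto (fun i => (m i : ℝ) / l i) F (𝓝 s))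
    (heven : ∀ i, Even (k i + (n i + m i))) :
    Tendsto (fun i => l i ^ 2 / 2 * ((1 - w i) ^ k i * stepProb4 (k i) (n i) (m i))) F
      (𝓝 (1 / Real.pi * besselKernel z (t ^ 2 + s ^ 2) v)) := by
  have h := (tendsto_one_sub_pow hl hk hw).mul (tendsto_sq_mul_stepProb4 hl hv hk hn hm heven)
  have e : Real.exp (-z * v) * (1 / Real.pi / v * Real.exp (-(t ^ 2 + s ^ 2) / v)) =
      1 / Real.pi * besselKernel z (t ^ 2 + s ^ 2) v := by
    rw [besselKernel, sub_eq_add_neg, Real.exp_add, neg_div]; ring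
  rw [e] at h
  exact h.congr fun i => by ring

end LocalLimit

/-! ### The Green function as an integral -/

theorem tsum_eq_integral_floor {f : ℕ → ℝ} (hf : Summable f) (h0 : ∀ j, 0 ≤ f j) :
    ∑' j, f j = ∫ u in Set.Ioi (0 : ℝ), f ⌊u⌋₊ := by
  have hfl : ∀ (j : ℕ) (u : ℝ), u ∈ Set.Ico (j : ℝ) (j + 1) → ⌊u⌋₊ = j := fun j u hu =>
    (Nat.floor_eq_iff ((Nat.cast_nonneg j).trans hu.1)).mpr hu
  have hU : ⋃ j : ℕ, Set.Ico (j : ℝ) (j + 1) = Set.Ici 0 := by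
    ext u
    simp only [Set.mem_iUnion, Set.mem_Ici]
    exact ⟨fun ⟨j, hj⟩ => (Nat.cast_nonneg j).trans hj.1,
      fun hu => ⟨⌊u⌋₊, Nat.floor_le hu, Nat.lt_floor_add_one u⟩⟩
  have hdisj : Pairwise (Function.onFun Disjoint fun j : ℕ => Set.Ico (j : ℝ) (j + 1)) := by
    intro i j hij
    refine Set.disjoint_left.mpr fun u hi hj => hij ?_
    rw [← hfl i u hi, hfl j u hj]
  have hI : ∀ j : ℕ, IntegrableOn (fun u : ℝ => f ⌊u⌋₊) (Set.Ico (j : ℝ) (j + 1)) := fun j =>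
    (integrableOn_const (C := f j) (by simp) (by simp)).congr_fun
      (fun u hu => by simp only [hfl j u hu]) measurableSet_Ico
  have hval : ∀ j : ℕ, ∫ u in Set.Ico (j : ℝ) (j + 1), f ⌊u⌋₊ = f j := fun j => by
    rw [setIntegral_congr_fun (g := fun _ => f j) measurableSet_Ico
      fun u hu => by simp only [hfl j u hu]]
    simp
  have hint : IntegrableOn (fun u : ℝ => f ⌊u⌋₊) (⋃ j : ℕ, Set.Ico (j : ℝ) (j + 1)) := by
    refine integrableOn_iUnion_of_summable_integral_norm hI ?_
    simp only [Real.norm_eq_abs, abs_of_nonneg (h0 _), hval]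
    exact hf
  have h := hasSum_integral_iUnion (fun _ => measurableSet_Ico) hdisj hint
  simp only [hval, hU] at h
  rw [h.tsum_eq, integral_Ici_eq_integral_Ioi]

theorem tsum_eq_integral_floor_mul {f : ℕ → ℝ} (hf : Summable f) (h0 : ∀ j, 0 ≤ f j) {c : ℝ}
    (hc : 0 < c) : ∑' j, f j = ∫ v in Set.Ioi (0 : ℝ), c * f ⌊c * v⌋₊ := by
  rw [tsum_eq_integral_floor hf h0, integral_const_mul,
    integral_comp_mul_left_Ioi (fun u => f ⌊u⌋₊) 0 hc, mul_zero, smul_eq_mul,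
    mul_inv_cancel_left₀ hc.ne']

/-- The number of steps in the `j`-th time of the parity class of `n`. -/
def parityTime (n : ℤ) (j : ℕ) : ℕ := 2 * j + (n % 2).toNat

theorem even_parityTime_add (n : ℤ) (j : ℕ) : Even ((parityTime n j : ℤ) + n) := by
  have h : ((parityTime n j : ℕ) : ℤ) = 2 * j + n % 2 := by
    have := Int.emod_nonneg n two_ne_zero
    simp only [parityTime]; push_cast; omega
  rw [h, Int.even_iff]; omega

theorem parityTime_bounds (n : ℤ) {u : ℝ} (hu : 0 ≤ u) :
    2 * u - 1 ≤ (parityTime n ⌊u⌋₊ : ℝ) + 1 ∧ u ≤ (parityTime n ⌊u⌋₊ : ℝ) + 1 ∧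
      (parityTime n ⌊u⌋₊ : ℝ) + 1 ≤ 2 * u + 2 := by
  have h1 := Nat.floor_le hu
  have h2 := Nat.lt_floor_add_one u
  have h3 : ((n % 2).toNat : ℝ) ≤ 1 := by
    have : (n % 2).toNat ≤ 1 := by omega
    exact_mod_cast this
  have h4 : (0 : ℝ) ≤ ((n % 2).toNat : ℝ) := Nat.cast_nonneg _
  have h5 : (0 : ℝ) ≤ (⌊u⌋₊ : ℝ) := Nat.cast_nonneg _
  simp only [parityTime]
  push_cast
  refine ⟨by linarith, by linarith, by linarith⟩

/-- Terms of the wrong parity vanish, so only the times `parityTime (n + m) j` are summed. With `c =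
l² / 2` the time at `v` is about `l² v`. -/
theorem green4_eq_integral (n m : ℤ) {a c : ℝ} (ha0 : 0 ≤ a) (ha1 : a < 1) (hc : 0 < c) :
    green4 n m a = ∫ v in Set.Ioi (0 : ℝ), c * (a ^ parityTime (n + m) ⌊c * v⌋₊ *
      stepProb4 (parityTime (n + m) ⌊c * v⌋₊) n m) := by
  have hinj : Function.Injective (parityTime (n + m)) := fun i j h => by
    simp only [parityTime] at h; omega
  have hs := summable_green4 n m ha0 ha1
  rw [green4, ← hinj.tsum_eq]
  · exact tsum_eq_integral_floor_mul (hs.comp_injective hinj)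
      (fun j => mul_nonneg (pow_nonneg ha0 _) (stepProb4_nonneg _ _ _)) hc
  · intro k hk
    by_contra hr
    apply hk
    have : Odd ((k : ℤ) + (n + m)) := by
      rw [← Int.not_even_iff_odd]
      intro he
      apply hr
      refine ⟨k / 2, ?_⟩
      rw [Int.even_iff] at he
      simp only [parityTime]; omega
    simp [stepProb4_eq_zero_of_odd k n m this]

/-! ### Convergence by domination -/

theorem tendsto_floor_mul_div {ι : Type*} {F : Filter ι} {l x : ι → ℝ} {t : ℝ}
    (hl : Tendsto l F atTop) (hx : Tendsto x F (𝓝 t)) :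
    Tendsto (fun i => (⌊l i * x i⌋ : ℝ) / l i) F (𝓝 t) := by
  have hlinv : Tendsto (fun i => (l i)⁻¹) F (𝓝 0) := tendsto_inv_atTop_zero.comp hl
  have hlo := hx.sub hlinv
  rw [sub_zero] at hlo
  refine tendsto_of_tendsto_of_tendsto_of_le_of_le' hlo hx ?_ ?_
  · filter_upwards [hl.eventually_gt_atTop 0] with i hi
    rw [le_div_iff₀ hi, sub_mul, inv_mul_cancel₀ hi.ne']
    linarith [Int.lt_floor_add_one (l i * x i)]
  · filter_upwards [hl.eventually_gt_atTop 0] with i hi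
    rw [div_le_iff₀ hi]
    linarith [Int.floor_le (l i * x i)]

/-- This is the integrable majorant. Distance from the origin, at least `√δ l`, removes the
singularity at `v = 0`; killing at rate at least `z₀` gives decay at infinity. -/
theorem sq_mul_one_sub_pow_mul_stepProb4_le {l z δ z₀ v : ℝ} {n m : ℤ} (hl : 0 < l)
    (hz0 : z₀ ≤ z) (hz : 0 < z) (hzl : z ≤ l ^ 2) (hδ : 0 < δ)
    (hnm : δ * l ^ 2 ≤ (n : ℝ) ^ 2 + (m : ℝ) ^ 2) (hv : 0 < v) (q : ℤ) :
    l ^ 2 / 2 * ((1 - z / l ^ 2) ^ parityTime q ⌊l ^ 2 / 2 * v⌋₊ *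
      stepProb4 (parityTime q ⌊l ^ 2 / 2 * v⌋₊) n m) ≤
      3 / δ * Real.exp 1 * Real.exp (-(z₀ / 2) * v) := by
  have hl2 : 0 < l ^ 2 := by positivity
  have hu : 0 ≤ l ^ 2 / 2 * v := by positivity
  have hku := (parityTime_bounds q hu).2.1
  set k := parityTime q ⌊l ^ 2 / 2 * v⌋₊
  have hk0 : (0 : ℝ) < k + 1 := by positivity
  set N2 := (n : ℝ) ^ 2 + (m : ℝ) ^ 2
  have hN : 0 < N2 := lt_of_lt_of_le (by positivity) hnm
  have hw1 : z / l ^ 2 ≤ 1 := (div_le_one hl2).mpr hzl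
  have h1 : (1 - z / l ^ 2) ^ k ≤ Real.exp 1 * Real.exp (-(z₀ / 2) * v) := by
    refine (one_sub_pow_le_exp hw1 k).trans ?_
    rw [← Real.exp_add]
    apply Real.exp_le_exp.mpr
    have a1 : z / l ^ 2 * (l ^ 2 / 2 * v) ≤ z / l ^ 2 * (k + 1) :=
      mul_le_mul_of_nonneg_left hku (by positivity)
    have a2 : z / l ^ 2 * (l ^ 2 / 2 * v) = z / 2 * v := by field_simp
    have a3 : z₀ / 2 * v ≤ z / 2 * v := by gcongr
    linarith
  have h2 : l ^ 2 / 2 * stepProb4 k n m ≤ 3 / δ := by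
    -- The bound `e^(-y) ≤ 1 / y` cancels the prefactor `6 / (k + 1)`, uniformly in `k`.
    have e1 : Real.exp (-N2 / (k + 1)) ≤ (k + 1) / N2 := by
      rw [neg_div, Real.exp_neg]
      refine inv_le_of_inv_le₀ (by positivity) ?_
      rw [inv_div]
      linarith [Real.add_one_le_exp (N2 / ((k : ℝ) + 1))]
    calc l ^ 2 / 2 * stepProb4 k n m ≤ l ^ 2 / 2 * (6 / (k + 1) * ((k + 1) / N2)) := by
          refine mul_le_mul_of_nonneg_left ((stepProb4_le k n m).trans ?_) (by positivity)
          exact mul_le_mul_of_nonneg_left e1 (by positivity)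
      _ = 3 * l ^ 2 / N2 := by field_simp; ring
      _ ≤ 3 / δ := by
          rw [div_le_div_iff₀ hN hδ]
          linarith
  calc _ = l ^ 2 / 2 * stepProb4 k n m * (1 - z / l ^ 2) ^ k := by ring
    _ ≤ 3 / δ * (Real.exp 1 * Real.exp (-(z₀ / 2) * v)) :=
        mul_le_mul h2 h1 (pow_nonneg (by linarith) _) (by positivity)
    _ = _ := by ring

/-- The parameters `x`, `y`, `c` may move with `l`: this joint form gives both the pointwise and the
uniform limit. -/
theorem tendsto_green4 {ι : Type*} {F : Filter ι} [F.IsCountablyGenerated] {l x y c : ι → ℝ}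
    {t s z : ℝ} (hl : Tendsto l F atTop) (hx : Tendsto x F (𝓝 t)) (hy : Tendsto y F (𝓝 s))
    (hc : Tendsto c F (𝓝 z)) (hts : (t, s) ≠ (0, 0)) (hz : 0 < z) :
    Tendsto (fun i => green4 ⌊l i * x i⌋ ⌊l i * y i⌋ (1 - c i / l i ^ 2)) F (𝓝 (h4 t s z)) := by
  have hρ := sq_add_sq_pos_of_ne hts
  have hn := tendsto_floor_mul_div hl hx
  have hm := tendsto_floor_mul_div hl hy
  have hl2 : Tendsto (fun i => l i ^ 2) F atTop := (tendsto_pow_atTop two_ne_zero).comp hl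
  have hl0 := hl.eventually_gt_atTop 0
  have hcz : ∀ᶠ i in F, z / 2 < c i := hc.eventually (lt_mem_nhds (half_lt_self hz))
  have hcl : ∀ᶠ i in F, c i < l i ^ 2 := by
    filter_upwards [hc.eventually (gt_mem_nhds (lt_add_one z)), hl2.eventually_gt_atTop (z + 1)]
      with i h1 h2
    exact h1.trans h2
  have hδ : ∀ᶠ i in F, (t ^ 2 + s ^ 2) / 2 * l i ^ 2 ≤
      (⌊l i * x i⌋ : ℝ) ^ 2 + (⌊l i * y i⌋ : ℝ) ^ 2 := by
    filter_upwards [((hn.pow 2).add (hm.pow 2)).eventually (lt_mem_nhds (half_lt_self hρ)), hl0]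
      with i h1 hi
    rw [div_pow, div_pow, ← add_div, lt_div_iff₀ (by positivity)] at h1
    exact h1.le
  rw [h4_eq_integral hts hz]
  have key : Tendsto (fun i => ∫ v in Set.Ioi (0 : ℝ), l i ^ 2 / 2 *
      ((1 - c i / l i ^ 2) ^ parityTime (⌊l i * x i⌋ + ⌊l i * y i⌋) ⌊l i ^ 2 / 2 * v⌋₊ *
        stepProb4 (parityTime (⌊l i * x i⌋ + ⌊l i * y i⌋) ⌊l i ^ 2 / 2 * v⌋₊)
          ⌊l i * x i⌋ ⌊l i * y i⌋)) F
      (𝓝 (∫ u in Set.Ioi (0 : ℝ), 1 / Real.pi * besselKernel z (t ^ 2 + s ^ 2) u)) := by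
    refine tendsto_integral_filter_of_dominated_convergence
      (fun v => 3 / ((t ^ 2 + s ^ 2) / 2) * Real.exp 1 * Real.exp (-(z / 2 / 2) * v)) ?_ ?_ ?_ ?_
    · refine Eventually.of_forall fun i => ?_
      have hfl : Measurable fun v : ℝ => ⌊l i ^ 2 / 2 * v⌋₊ :=
        Nat.measurable_floor.comp (measurable_const_mul _)
      exact (((measurable_from_nat (f := fun j : ℕ => l i ^ 2 / 2 *
        ((1 - c i / l i ^ 2) ^ parityTime (⌊l i * x i⌋ + ⌊l i * y i⌋) j *
        stepProb4 (parityTime (⌊l i * x i⌋ + ⌊l i * y i⌋) j)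
          ⌊l i * x i⌋ ⌊l i * y i⌋))).comp hfl)).aestronglyMeasurable
    · filter_upwards [hl0, hcz, hcl, hδ] with i hi h1 h2 h3
      refine (ae_restrict_iff' measurableSet_Ioi).mpr (ae_of_all _ fun v hv => ?_)
      have hw : 0 ≤ 1 - c i / l i ^ 2 :=
        sub_nonneg.mpr ((div_le_one (by positivity)).mpr h2.le)
      rw [Real.norm_eq_abs, abs_of_nonneg (mul_nonneg (by positivity)
        (mul_nonneg (pow_nonneg hw _) (stepProb4_nonneg _ _ _)))]
      exact sq_mul_one_sub_pow_mul_stepProb4_le hi h1.le ((half_pos hz).trans h1) h2.le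
        (half_pos hρ) h3 hv _
    · exact (integrableOn_exp_mul_Ioi (by linarith) 0).const_mul _
    · refine (ae_restrict_iff' measurableSet_Ioi).mpr (ae_of_all _ fun v hv => ?_)
      have hv0 : 0 < v := hv
      refine tendsto_sq_mul_one_sub_pow_mul_stepProb4 hl hv0 ?_ ?_ hn hm
        fun i => even_parityTime_add _ _
      · have hinv : Tendsto (fun i => (l i ^ 2)⁻¹) F (𝓝 0) := tendsto_inv_atTop_zero.comp hl2
        have hlo := hinv.const_sub v
        have hup := (hinv.const_mul 2).const_add v
        rw [sub_zero] at hlo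
        rw [mul_zero, add_zero] at hup
        refine tendsto_of_tendsto_of_tendsto_of_le_of_le' hlo hup ?_ ?_
        · filter_upwards [hl0] with i hi
          have hb := (parityTime_bounds (⌊l i * x i⌋ + ⌊l i * y i⌋)
            (by positivity : 0 ≤ l i ^ 2 / 2 * v)).1
          rw [le_div_iff₀ (by positivity), sub_mul, inv_mul_cancel₀ (by positivity)]
          linarith
        · filter_upwards [hl0] with i hi
          have hb := (parityTime_bounds (⌊l i * x i⌋ + ⌊l i * y i⌋)
            (by positivity : 0 ≤ l i ^ 2 / 2 * v)).2.2
          rw [div_le_iff₀ (by positivity), add_mul, mul_assoc, inv_mul_cancel₀ (by positivity)]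
          linarith
      · refine hc.congr' ?_
        filter_upwards [hl0] with i hi
        field_simp
  refine key.congr' ?_
  filter_upwards [hl0, hcz, hcl] with i hi h1 h2
  have hc0 : 0 < c i := (half_pos hz).trans h1
  refine (green4_eq_integral _ _ ?_ ?_ (by positivity)).symm
  · exact sub_nonneg.mpr ((div_le_one (by positivity)).mpr h2.le)
  · linarith [div_pos hc0 (by positivity : 0 < l i ^ 2)]

/-! ### Uniform convergence -/

theorem isCompact_annulus_prod (ε : ℝ) :
    IsCompact {p : ℝ × ℝ × ℝ | (ε ≤ |p.1| + |p.2.1| ∧ |p.1| + |p.2.1| ≤ 1 / ε) ∧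
      ε ≤ p.2.2 ∧ p.2.2 ≤ 1 / ε} := by
  refine ((isCompact_Icc (a := -(1 / ε)) (b := 1 / ε)).prod
    ((isCompact_Icc (a := -(1 / ε)) (b := 1 / ε)).prod
      (isCompact_Icc (a := ε) (b := 1 / ε)))).of_isClosed_subset ?_ ?_
  · simp only [Set.ofPred_and]
    refine IsClosed.inter (IsClosed.inter ?_ ?_) (IsClosed.inter ?_ ?_) <;>
      exact isClosed_le (by fun_prop) (by fun_prop)
  · rintro ⟨t, s, z⟩ ⟨⟨_, h2⟩, h3, h4⟩
    simp only at h2 h3 h4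
    exact ⟨abs_le.mp (by linarith [abs_nonneg s]), abs_le.mp (by linarith [abs_nonneg t]), h3, h4⟩

/-- On the compact closed version of the set, uniform convergence is local. Locally it means that
both functions tend to `h4 t s z` as `(l, p)` tends to `(∞, (t, s, z))`; for `h4` this is
continuity. -/
theorem green4_tendstoUniformlyOn {ε : ℝ} (hε : 0 < ε) :
    TendstoUniformlyOn
      (fun (l : ℝ) (p : ℝ × ℝ × ℝ) => green4 ⌊l * p.1⌋ ⌊l * p.2.1⌋ (1 - p.2.2 / l ^ 2))
      (fun p : ℝ × ℝ × ℝ => h4 p.1 p.2.1 p.2.2) atTop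
      {p : ℝ × ℝ × ℝ | (ε < |p.1| + |p.2.1| ∧ |p.1| + |p.2.1| < 1 / ε) ∧
        ε < p.2.2 ∧ p.2.2 < 1 / ε} := by
  refine ((tendstoLocallyUniformlyOn_iff_tendstoUniformlyOn_of_compact
    (isCompact_annulus_prod ε)).mp ?_).mono
      fun p hp => ⟨⟨hp.1.1.le, hp.1.2.le⟩, hp.2.1.le, hp.2.2.le⟩
  rw [tendstoLocallyUniformlyOn_iff_forall_tendsto]
  rintro ⟨t, s, z⟩ ⟨⟨h1, _⟩, h3, _⟩
  simp only at h1 h3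
  have hts : (t, s) ≠ (0, 0) := by
    intro h
    obtain ⟨rfl, rfl⟩ := Prod.mk.inj h
    simp at h1
    linarith
  have hz : 0 < z := hε.trans_le h3
  refine Tendsto.mono_left ?_ (Filter.prod_mono le_rfl nhdsWithin_le_nhds)
  have hsnd : Tendsto (fun y : ℝ × ℝ × ℝ × ℝ => y.2) (atTop ×ˢ 𝓝 (t, s, z)) (𝓝 (t, s, z)) :=
    tendsto_snd
  have hh := (continuousAt_h4 hts hz).tendsto.comp hsnd
  have hg := tendsto_green4 (F := atTop ×ˢ 𝓝 (t, s, z)) (l := fun y => y.1) tendsto_fst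
    ((continuous_fst.tendsto _).comp hsnd)
    (((continuous_fst.comp continuous_snd).tendsto _).comp hsnd)
    (((continuous_snd.comp continuous_snd).tendsto _).comp hsnd) hts hz
  exact (hh.prodMk_nhds hg).mono_right (nhds_le_uniformity _)

theorem mainTheorem6 :
    -- pointwise convergence
    (∀ t s z : ℝ, (t, s) ≠ (0, 0) → 0 < z →
      Tendsto (fun l : ℝ => green4 ⌊l * t⌋ ⌊l * s⌋ (1 - z / l ^ 2)) atTop (𝓝 (h4 t s z))) ∧
    -- uniform convergence
    (∀ ε : ℝ, 0 < ε →
      TendstoUniformlyOn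
        (fun (l : ℝ) (p : ℝ × ℝ × ℝ) => green4 ⌊l * p.1⌋ ⌊l * p.2.1⌋ (1 - p.2.2 / l ^ 2))
        (fun p : ℝ × ℝ × ℝ => h4 p.1 p.2.1 p.2.2) atTop
        {p : ℝ × ℝ × ℝ | (ε < |p.1| + |p.2.1| ∧ |p.1| + |p.2.1| < 1 / ε) ∧
          ε < p.2.2 ∧ p.2.2 < 1 / ε}) ∧
    -- dominating bound
    (∃ C c : ℝ, 0 < C ∧ 0 < c ∧ ∀ᶠ l : ℝ in atTop, ∀ t s z : ℝ,
      (t, s) ≠ (0, 0) → 0 < z → z < l ^ 2 →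
      green4 ⌊l * t⌋ ⌊l * s⌋ (1 - z / l ^ 2) <
        C * (h4 t s z +
          Real.exp (-c * Real.sqrt l * (|t| ^ (1 / 2 : ℝ) + |s| ^ (1 / 2 : ℝ))))) :=
  ⟨fun _ _ _ hts hz => tendsto_green4 tendsto_id tendsto_const_nhds tendsto_const_nhds
      tendsto_const_nhds hts hz,
    fun _ hε => green4_tendstoUniformlyOn hε, green4_dominated⟩
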